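/- Let $\{a_k\}_{k\ge 1}$ be a sequence of positive integers satisfying the condition $$(*)\qquad \lim_{N\to\infty}\frac{1}{N^2}\,\#\{(i,j)\in[1,N]^2 : |a_i-a_j|\le L\}=0\quad\text{for every } L>0 .$$ Let $(X,\mathcal B,\mu,T)$ be a measure-preserving system, that is, $(X,\mathcal B,\mu)$ is a probability space and $T\colon X\to X$ is an invertible (with measurable inverse) measure-preserving transformation. Let $$P_\mu(T)=\{A\in\mathcal B : h_\mu(T,\{A,X\setminus A\})=0\}$$ be its Pinsker $\sigma$-algebra, where for a finite measurable partition $\alpha$ of $X$ $$h_\mu(T,\alpha)=\lim_{n\to\infty}\frac1n H_\mu\Bigl(\bigvee_{i=0}^{n-1}T^{-i}\alpha\Bigr),\qquad H_\mu(\beta)=-\sum_{B\in\beta}\mu(B)\log\mu(B),$$ with the convention $0\log 0=0$. Then $P_\mu(T)$ is a characteristic $\sigma$-algebra for the sequence $\{a_k\}$: it is a sub-$\sigma$-algebra of $\mathcal B$ and for every (real- or complex-valued) $f\in L^2(\mu)$, $$\frac1N\sum_{k=1}^N T^{a_k}f-\frac1N\sum_{k=1}^N T^{a_k}E(f\mid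 P_\mu(T))\longrightarrow 0\quad\text{in } L^2(\mu)\text{ as } N\to\infty,$$ where $T^m f=f\circ T^m$ and $E(\,\cdot\mid P_\mu(T))$ is the conditional expectation with respect to $P_\mu(T)$. -/

import Mathlib

open MeasureTheory Filter Topology

namespace PinskerChar

/-- Condition (∗) on a sequence `(a k)`, `k ≥ 1`: for every real `L > 0` the proportion of pairs
`(i, j) ∈ [1, N]²` with `|a i - a j| ≤ L` tends to `0` as `N → ∞`. The value `a 0` is not used. -/
def ConditionStar (a : ℕ → ℕ) : Prop :=
  ∀ L : ℝ, 0 < L →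
    Tendsto (fun N : ℕ =>
      (((Finset.Icc 1 N ×ˢ Finset.Icc 1 N).filter
        (fun p : ℕ × ℕ => |(a p.1 : ℝ) - (a p.2 : ℝ)| ≤ L)).card : ℝ) / (N : ℝ) ^ 2)
      atTop (𝓝 0)

variable {X : Type*} [MeasurableSpace X]

/-- A finite partition of `X`, indexed by a finite type `ι`, is given by the map `α : X → ι` sending
a point to the index of its cell. This is its Shannon entropy `∑ i, - μ(Aᵢ) log μ(Aᵢ)`. -/
noncomputable def partitionEntropy (μ : Measure X) {ι : Type*} [Fintype ι] (α : X → ι) : ℝ :=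
  ∑ i, Real.negMulLog (μ.real (α ⁻¹' {i}))

/-- The refined partition `⋁_{0 ≤ i < n} T⁻ⁱ α`: two points are in the same cell iff
`α (Tⁱ x) = α (Tⁱ y)` for all `i < n`. -/
def refinement {ι : Type*} (T : X → X) (α : X → ι) (n : ℕ) : X → (Fin n → ι) :=
  fun x i => α (T^[(i : ℕ)] x)

/-- The measure-theoretic entropy `h_μ(T, α) = lim (1/n) H_μ(⋁_{0 ≤ i < n} T⁻ⁱ α)`. It is written as
an upper limit; `tendsto_entropy` shows that it is a limit when `T` preserves `μ`. -/
noncomputable def entropy (μ : Measure X) (T : X → X) {ι : Type*} [Fintype ι] (α : X → ι) : ℝ :=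
  limsup (fun n : ℕ => partitionEntropy μ (refinement T α n) / (n : ℝ)) atTop

/-- The two-set partition `{A, X \ A}`, with the index of a cell in `Prop`. -/
def twoSet (A : Set X) : X → Prop := fun x => x ∈ A

section Facts

set_option linter.unusedSectionVars false

variable {μ : Measure X} [IsProbabilityMeasure μ]
  {ι : Type*} [Fintype ι] [MeasurableSpace ι] [MeasurableSingletonClass ι]
  {κ : Type*} [Fintype κ] [MeasurableSpace κ] [MeasurableSingletonClass κ]

lemma partitionEntropy_nonneg (α : X → ι) : 0 ≤ partitionEntropy μ α :=
  Finset.sum_nonneg fun _ _ => Real.negMulLog_nonneg measureReal_nonneg measureReal_le_one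

lemma sum_fiber {α : X → ι} (hα : Measurable α) {S : Set X} (hS : MeasurableSet S) :
    ∑ i, μ.real (S ∩ α ⁻¹' {i}) = μ.real S := by
  rw [← measureReal_iUnion_fintype]
  · congr 1
    ext x
    simp
  · intro i j hij
    refine Set.disjoint_left.2 fun x hx hy => hij ?_
    have h1 := hx.2
    have h2 := hy.2
    simp only [Set.mem_preimage, Set.mem_singleton_iff] at h1 h2
    exact h1.symm.trans h2
  · intro i
    exact hS.inter (hα (measurableSet_singleton i))

lemma partitionEntropy_pair_le {α : X → ι} {β : X → κ} (hα : Measurable α) (hβ : Measurable β) :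
    partitionEntropy μ (fun x => (α x, β x)) ≤ partitionEntropy μ α + partitionEntropy μ β := by
  classical
  set p : ι → ℝ := fun i => μ.real (α ⁻¹' {i}) with hp
  set q : κ → ℝ := fun j => μ.real (β ⁻¹' {j}) with hq
  set r : ι → κ → ℝ := fun i j => μ.real (α ⁻¹' {i} ∩ β ⁻¹' {j}) with hr
  have hpr : ∀ i, ∑ j, r i j = p i := fun i => sum_fiber hβ (hα (measurableSet_singleton i))
  have hqr : ∀ j, ∑ i, r i j = q j := by
    intro j
    have := sum_fiber (μ := μ) hα (hβ (measurableSet_singleton j))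
    simpa only [hr, hq, Set.inter_comm] using this
  have hp1 : ∑ i, p i = 1 := by
    have := sum_fiber (μ := μ) hα MeasurableSet.univ
    simpa [hp] using this
  have hq1 : ∑ j, q j = 1 := by
    have := sum_fiber (μ := μ) hβ MeasurableSet.univ
    simpa [hq] using this
  have hle1 : ∀ i j, r i j ≤ p i := fun i j => measureReal_mono Set.inter_subset_left
  have hle2 : ∀ i j, r i j ≤ q j := fun i j => measureReal_mono Set.inter_subset_right
  have hr0 : ∀ i j, 0 ≤ r i j := fun i j => measureReal_nonneg
  have key : ∀ i j, Real.negMulLog (r i j) ≤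
      -(r i j * Real.log (p i)) - r i j * Real.log (q j) + (p i * q j - r i j) := by
    intro i j
    rcases (hr0 i j).eq_or_lt with h | h
    · rw [← h]
      simp only [Real.negMulLog_zero, zero_mul, neg_zero, sub_zero, zero_add]
      exact mul_nonneg measureReal_nonneg measureReal_nonneg
    · have hpi : 0 < p i := h.trans_le (hle1 i j)
      have hqj : 0 < q j := h.trans_le (hle2 i j)
      have hl := Real.log_le_sub_one_of_pos (div_pos (mul_pos hpi hqj) h)
      rw [Real.log_div (mul_pos hpi hqj).ne' h.ne', Real.log_mul hpi.ne' hqj.ne'] at hl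
      have h2 := mul_le_mul_of_nonneg_left hl h.le
      have h3 : r i j * (p i * q j / r i j - 1) = p i * q j - r i j := by field_simp
      rw [h3] at h2
      rw [Real.negMulLog]
      linarith
  have e1 : partitionEntropy μ (fun x => (α x, β x)) = ∑ i, ∑ j, Real.negMulLog (r i j) := by
    rw [partitionEntropy, Fintype.sum_prod_type]
    refine Finset.sum_congr rfl fun i _ => Finset.sum_congr rfl fun j _ => ?_
    congr 2
    ext x
    simp
  have e2 : ∑ i, ∑ j, r i j * Real.log (p i) = -partitionEntropy μ α := by
    rw [partitionEntropy, ← Finset.sum_neg_distrib]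
    refine Finset.sum_congr rfl fun i _ => ?_
    rw [← Finset.sum_mul, hpr, Real.negMulLog]
    ring
  have e3 : ∑ i, ∑ j, r i j * Real.log (q j) = -partitionEntropy μ β := by
    rw [Finset.sum_comm, partitionEntropy, ← Finset.sum_neg_distrib]
    refine Finset.sum_congr rfl fun j _ => ?_
    rw [← Finset.sum_mul, hqr, Real.negMulLog]
    ring
  have e4 : ∑ i, ∑ j, p i * q j = 1 := by
    simp_rw [← Finset.mul_sum, hq1, mul_one, hp1]
  have e5 : ∑ i, ∑ j, r i j = 1 := by simp_rw [hpr, hp1]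
  have := Finset.sum_le_sum fun i (_ : i ∈ Finset.univ) =>
    Finset.sum_le_sum fun j (_ : j ∈ Finset.univ) => key i j
  simp only [Finset.sum_add_distrib, Finset.sum_sub_distrib, Finset.sum_neg_distrib] at this
  rw [e2, e3, e4, e5] at this
  rw [e1]
  linarith

lemma partitionEntropy_comp_le {α : X → ι} (hα : Measurable α) (g : ι → κ) :
    partitionEntropy μ (fun x => g (α x)) ≤ partitionEntropy μ α := by
  classical
  have hg : Measurable g := measurable_of_finite g
  have h1 : ∀ k, ∑ i, μ.real ((fun x => g (α x)) ⁻¹' {k} ∩ α ⁻¹' {i})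
      = μ.real ((fun x => g (α x)) ⁻¹' {k}) :=
    fun k => sum_fiber hα ((hg.comp hα) (measurableSet_singleton k))
  have h2 : ∀ k, Real.negMulLog (μ.real ((fun x => g (α x)) ⁻¹' {k})) ≤
      ∑ i, if g i = k then Real.negMulLog (μ.real (α ⁻¹' {i})) else 0 := by
    intro k
    rw [Real.negMulLog]
    nth_rewrite 1 [← h1 k]
    rw [← Finset.sum_neg_distrib, Finset.sum_mul]
    refine Finset.sum_le_sum fun i _ => ?_
    split_ifs with h
    · have e : (fun x => g (α x)) ⁻¹' {k} ∩ α ⁻¹' {i} = α ⁻¹' {i} := by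
        refine Set.inter_eq_right.2 fun x hx => ?_
        have hx' : α x = i := hx
        simp [hx', h]
      have hsub : α ⁻¹' {i} ⊆ (fun x => g (α x)) ⁻¹' {k} := Set.inter_eq_right.1 e
      rw [e, Real.negMulLog]
      rcases (measureReal_nonneg (μ := μ) (s := α ⁻¹' {i})).eq_or_lt with h0 | h0
      · simp [← h0]
      · have := Real.log_le_log h0 (measureReal_mono (μ := μ) hsub)
        nlinarith
    · have e : (fun x => g (α x)) ⁻¹' {k} ∩ α ⁻¹' {i} = ∅ := by
        refine Set.eq_empty_of_forall_notMem fun x hx => h ?_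
        have hx' : α x = i := hx.2
        have hx2 : g (α x) = k := hx.1
        rw [← hx', hx2]
      simp [e]
  calc partitionEntropy μ (fun x => g (α x))
      ≤ ∑ k, ∑ i, if g i = k then Real.negMulLog (μ.real (α ⁻¹' {i})) else 0 :=
        Finset.sum_le_sum fun k _ => h2 k
    _ = partitionEntropy μ α := by
        rw [Finset.sum_comm, partitionEntropy]
        simp

lemma partitionEntropy_le_of_factor {α : X → ι} (hα : Measurable α) {β : X → κ} (g : ι → κ)
    (h : ∀ x, β x = g (α x)) : partitionEntropy μ β ≤ partitionEntropy μ α := by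
  obtain rfl : β = fun x => g (α x) := funext h
  exact partitionEntropy_comp_le hα g

lemma measurable_refinement {T : X → X} (hT : Measurable T) {α : X → ι} (hα : Measurable α)
    (n : ℕ) : Measurable (refinement T α n) :=
  measurable_pi_lambda _ fun i => hα.comp (hT.iterate i)

lemma subadditive_refinement {T : X → X} (hT : MeasurePreserving T μ μ) {α : X → ι}
    (hα : Measurable α) : Subadditive fun n => partitionEntropy μ (refinement T α n) := by
  intro m n
  have hm := measurable_refinement hT.measurable hα m
  have hn := measurable_refinement hT.measurable hα n
  have hTm := hT.iterate m
  have hn' : Measurable fun x => refinement T α n (T^[m] x) := hn.comp hTm.measurable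
  have e1 : ∀ x, refinement T α (m + n) x =
      (fun P : (Fin m → ι) × (Fin n → ι) => Fin.append P.1 P.2)
        (refinement T α m x, refinement T α n (T^[m] x)) := by
    intro x
    funext i
    refine Fin.addCases (fun j => ?_) (fun j => ?_) i
    · simp [refinement]
    · simp [refinement, Fin.append_right, ← Function.iterate_add_apply, add_comm]
  have e2 : partitionEntropy μ (fun x => refinement T α n (T^[m] x))
      = partitionEntropy μ (refinement T α n) := by
    refine Finset.sum_congr rfl fun i _ => ?_
    congr 1
    exact hTm.measureReal_preimage (hn (measurableSet_singleton i)).nullMeasurableSet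
  calc partitionEntropy μ (refinement T α (m + n))
      ≤ partitionEntropy μ (fun x => (refinement T α m x, refinement T α n (T^[m] x))) := by
        exact partitionEntropy_le_of_factor (hm.prodMk hn')
          (fun P : (Fin m → ι) × (Fin n → ι) => Fin.append P.1 P.2) e1
    _ ≤ _ := by
        exact (partitionEntropy_pair_le hm hn').trans_eq (by rw [e2])

lemma bddBelow_refinement (T : X → X) (α : X → ι) :
    BddBelow (Set.range fun n : ℕ => partitionEntropy μ (refinement T α n) / (n : ℝ)) :=
  ⟨0, by
    rintro _ ⟨n, rfl⟩
    exact div_nonneg (partitionEntropy_nonneg _) n.cast_nonneg⟩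

theorem tendsto_entropy {T : X → X} (hT : MeasurePreserving T μ μ) {α : X → ι}
    (hα : Measurable α) :
    Tendsto (fun n : ℕ => partitionEntropy μ (refinement T α n) / (n : ℝ)) atTop
      (𝓝 (entropy μ T α)) := by
  have h := (subadditive_refinement hT hα).tendsto_lim (bddBelow_refinement T α)
  rw [entropy, h.limsup_eq]
  exact h

lemma entropy_nonneg {T : X → X} (hT : MeasurePreserving T μ μ) {α : X → ι} (hα : Measurable α) :
    0 ≤ entropy μ T α :=
  ge_of_tendsto' (tendsto_entropy hT hα) fun n =>
    div_nonneg (partitionEntropy_nonneg _) n.cast_nonneg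

lemma entropy_le {T : X → X} (hT : MeasurePreserving T μ μ) {α : X → ι} (hα : Measurable α) :
    entropy μ T α ≤ partitionEntropy μ α := by
  have h := (subadditive_refinement hT hα).tendsto_lim (bddBelow_refinement T α)
  have h1 := (subadditive_refinement hT hα).lim_le_div (bddBelow_refinement T α) one_ne_zero
  have h2 : partitionEntropy μ (refinement T α 1) ≤ partitionEntropy μ α := by
    refine partitionEntropy_le_of_factor hα (fun i : ι => fun _ : Fin 1 => i) fun x => ?_
    funext i
    simp [refinement]
  rw [entropy, h.limsup_eq]
  refine h1.trans ?_
  simpa using h2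

lemma measurable_twoSet {A : Set X} (hA : MeasurableSet A) : Measurable (twoSet A) :=
  measurableSet_setOfPred.1 hA

lemma entropy_union_le {T : X → X} (hT : MeasurePreserving T μ μ) {A B : Set X}
    (hA : MeasurableSet A) (hB : MeasurableSet B) :
    entropy μ T (twoSet (A ∪ B)) ≤ entropy μ T (twoSet A) + entropy μ T (twoSet B) := by
  refine le_of_tendsto_of_tendsto' (tendsto_entropy hT (measurable_twoSet (hA.union hB)))
    ((tendsto_entropy hT (measurable_twoSet hA)).add (tendsto_entropy hT (measurable_twoSet hB)))
    fun n => ?_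
  rw [← add_div]
  refine div_le_div_of_nonneg_right ?_ n.cast_nonneg
  have mA := measurable_refinement hT.measurable (measurable_twoSet hA) n
  have mB := measurable_refinement hT.measurable (measurable_twoSet hB) n
  exact (partitionEntropy_le_of_factor (mA.prodMk mB)
    (fun P : (Fin n → Prop) × (Fin n → Prop) => fun i => P.1 i ∨ P.2 i) fun _ => rfl).trans
    (partitionEntropy_pair_le mA mB)

lemma partitionEntropy_twoSet {A : Set X} (hA : MeasurableSet A) :
    partitionEntropy μ (twoSet A)
      = Real.negMulLog (μ.real A) + Real.negMulLog (1 - μ.real A) := by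
  have e1 : twoSet A ⁻¹' {True} = A := by
    ext x
    simp [twoSet]
  have e2 : twoSet A ⁻¹' {False} = Aᶜ := by
    ext x
    simp [twoSet]
  rw [partitionEntropy, Fintype.univ_Prop]
  simp [e1, e2, probReal_compl_eq_one_sub hA]

lemma entropy_empty {T : X → X} (hT : MeasurePreserving T μ μ) :
    entropy μ T (twoSet (∅ : Set X)) = 0 := by
  refine le_antisymm ?_ (entropy_nonneg hT (measurable_twoSet MeasurableSet.empty))
  refine (entropy_le hT (measurable_twoSet MeasurableSet.empty)).trans ?_
  simp [partitionEntropy_twoSet MeasurableSet.empty]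

lemma entropy_compl_le {T : X → X} (hT : MeasurePreserving T μ μ) {A : Set X}
    (hA : MeasurableSet A) : entropy μ T (twoSet Aᶜ) ≤ entropy μ T (twoSet A) := by
  refine le_of_tendsto_of_tendsto' (tendsto_entropy hT (measurable_twoSet hA.compl))
    (tendsto_entropy hT (measurable_twoSet hA)) fun n => ?_
  refine div_le_div_of_nonneg_right ?_ n.cast_nonneg
  exact partitionEntropy_le_of_factor
    (measurable_refinement hT.measurable (measurable_twoSet hA) n)
    (fun P : Fin n → Prop => fun i => ¬ P i) fun _ => rfl

lemma entropy_iUnion {T : X → X} (hT : MeasurePreserving T μ μ) {f : ℕ → Set X}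
    (hf : ∀ n, MeasurableSet (f n)) (h0 : ∀ n, entropy μ T (twoSet (f n)) = 0) :
    entropy μ T (twoSet (⋃ n, f n)) = 0 := by
  have hU : MeasurableSet (⋃ n, f n) := MeasurableSet.iUnion hf
  have hB : ∀ n, MeasurableSet (Set.accumulate f n) := fun n =>
    MeasurableSet.biUnion (Set.to_countable _) fun i _ => hf i
  have hB0 : ∀ n, entropy μ T (twoSet (Set.accumulate f n)) ≤ 0 := by
    intro n
    induction n with
    | zero => rw [Set.accumulate_zero_nat]; exact (h0 0).le
    | succ n ih =>
      rw [Set.accumulate_succ]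
      refine (entropy_union_le hT (hB n) (hf (n + 1))).trans ?_
      rw [h0]
      linarith
  set D : ℕ → Set X := fun n => (⋃ n, f n) \ Set.accumulate f n with hD
  have hDm : ∀ n, MeasurableSet (D n) := fun n => hU.diff (hB n)
  have hsub : ∀ n, Set.accumulate f n ⊆ ⋃ n, f n := fun n => Set.accumulate_subset_iUnion n
  have hlim : Tendsto (fun n => μ.real (D n)) atTop (𝓝 0) := by
    have h1 : Tendsto (fun n => μ.real (Set.accumulate f n)) atTop (𝓝 (μ.real (⋃ n, f n))) :=
      (ENNReal.tendsto_toReal (measure_ne_top _ _)).comp tendsto_measure_iUnion_accumulate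
    have h2 := h1.const_sub (μ.real (⋃ n, f n))
    rw [sub_self] at h2
    refine h2.congr fun n => ?_
    exact (measureReal_sdiff (hsub n) (hB n)).symm
  have hlim2 : Tendsto (fun n => partitionEntropy μ (twoSet (D n))) atTop (𝓝 0) := by
    have c : Continuous fun t : ℝ => Real.negMulLog t + Real.negMulLog (1 - t) := by fun_prop
    have h1 := (c.tendsto 0).comp hlim
    simp only [Real.negMulLog_zero, sub_zero, Real.negMulLog_one, add_zero] at h1
    refine h1.congr fun n => ?_
    exact (partitionEntropy_twoSet (hDm n)).symm
  refine le_antisymm (ge_of_tendsto' hlim2 fun n => ?_)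
    (entropy_nonneg hT (measurable_twoSet hU))
  have e : (⋃ n, f n) = Set.accumulate f n ∪ D n := (Set.union_sdiff_cancel (hsub n)).symm
  calc entropy μ T (twoSet (⋃ n, f n))
      ≤ entropy μ T (twoSet (Set.accumulate f n)) + entropy μ T (twoSet (D n)) := by
        rw [e]
        exact entropy_union_le hT (hB n) (hDm n)
    _ ≤ 0 + partitionEntropy μ (twoSet (D n)) :=
        add_le_add (hB0 n) (entropy_le hT (measurable_twoSet (hDm n)))
    _ = _ := zero_add _

end Facts

/-- The Pinsker σ-algebra `P_μ(T) = {A ∈ 𝓑 : h_μ(T, {A, X \ A}) = 0}` of a system `(X, 𝓑, μ, T)`. -/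
@[reducible]
noncomputable def pinsker (μ : Measure X) [IsProbabilityMeasure μ] {T : X → X}
    (hT : MeasurePreserving T μ μ) : MeasurableSpace X where
  MeasurableSet' A := MeasurableSet A ∧ entropy μ T (twoSet A) = 0
  measurableSet_empty := ⟨MeasurableSet.empty, entropy_empty hT⟩
  measurableSet_compl _ hA := ⟨hA.1.compl, le_antisymm
    ((entropy_compl_le hT hA.1).trans hA.2.le)
    (entropy_nonneg hT (measurable_twoSet hA.1.compl))⟩
  measurableSet_iUnion _ hf :=
    ⟨MeasurableSet.iUnion fun n => (hf n).1, entropy_iUnion hT (fun n => (hf n).1) fun n => (hf n).2⟩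

/-- The ergodic average `(1/N) ∑_{k=1}^N T^{a k} f`, where `(T^m f)(x) = f (T^m x)`. -/
noncomputable def average {𝕜 : Type*} [RCLike 𝕜] (T : X → X) (a : ℕ → ℕ) (f : X → 𝕜) (N : ℕ) :
    X → 𝕜 :=
  fun x => (N : 𝕜)⁻¹ * ∑ k ∈ Finset.Icc 1 N, f (T^[a k] x)

/-- `F` is a characteristic σ-algebra for the sequence `(a k)`, `k ≥ 1`, in the system
`(X, 𝓑, μ, T)`: it is a sub-σ-algebra of `𝓑`, and for every `f ∈ L²(μ)` (with scalars `𝕜 = ℝ` or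
`ℂ`) the averages of `f` and of `E(f | F)` along the sequence differ by a function tending to `0`
in `L²(μ)`. -/
def IsCharacteristic (𝕜 : Type*) [RCLike 𝕜] (μ : Measure X) (T : X → X)
    (F : MeasurableSpace X) (a : ℕ → ℕ) : Prop :=
  F ≤ ‹MeasurableSpace X› ∧
  ∀ f : X → 𝕜, MemLp f 2 μ →
    Tendsto (fun N : ℕ => eLpNorm (average T a f N - average T a (μ[f | F]) N) 2 μ) atTop (𝓝 0)

end PinskerChar

/-!
The system is strongly mixing relative to its Pinsker σ-algebra: if `g ∈ L²(μ)` is orthogonal to the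
Pinsker-measurable functions, then `⟨g ∘ Tⁿ, g⟩ → 0` (`tendsto_inner_koopman`). Apply this to
`g = f - E(f | P_μ(T))` and expand the squared norm of `(1/N) ∑ T^{a k} g` into correlations
`⟨T^{a i} g, T^{a j} g⟩`, whose absolute value depends only on `|a i - a j|`. By condition (∗) all but
`o(N²)` pairs have a large gap, hence a small correlation (`tendsto_norm_average`).

For the mixing statement, approximate `g` by a function `s` with finitely many values, and let `α` be
the partition into its level sets. Then `s ∘ Tⁿ` is measurable for the future `σ(α ∘ Tⁱ : i ≥ n)`.
The intersection of these futures lies in the Pinsker σ-algebra, so `g` is orthogonal to the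
intersection of the corresponding subspaces of `L²(μ)`, hence nearly orthogonal to one of them
(`tendsto_inner_of_approx`).

That the tail of `α` has zero entropy (`entropy_twoSet_eq_zero_of_approx`) is proved with finite
partitions only. Write `β` for the partition `{A, X \ A}`, `α_m^n = ⋁_{m ≤ i < n} T⁻ⁱ α`, and
`c n = H(α_0^n)`. As `A` is nearly determined by finitely many coordinates,
`H(α_0^n ∨ β_0^n) ≤ c n + O(1) + ε n`. As `A` is also nearly determined by coordinates beyond `n`,
conditioning on a long block `α_n^{n+m}` gives
`H(α_0^n | β_0^n) ≥ H(α_0^n | α_n^{n+m}) - ε n = c (n + m) - c m - ε n`, and this is at least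
`n h(α) - ε n` because the increments of `c` decrease to `h(α)`. Subtracting,
`H(β_0^n) ≤ c n - n h(α) + 2 ε n + O(1)`, which is `o(n) + 2 ε n`.
-/

namespace PinskerChar

set_option linter.unusedSectionVars false

variable {X : Type*} [MeasurableSpace X] {μ : Measure X} [IsProbabilityMeasure μ]
  {ι : Type*} [Fintype ι] [MeasurableSpace ι] [MeasurableSingletonClass ι]
  {κ : Type*} [Fintype κ] [MeasurableSpace κ] [MeasurableSingletonClass κ]
  {τ : Type*} [Fintype τ] [MeasurableSpace τ] [MeasurableSingletonClass τ]

/-! ### Entropy of finite partitions -/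

/-- A partition whose cells are unions of cells of `α` has at most the entropy of `α`. -/
lemma partitionEntropy_le_of_determined {α : X → ι} (hα : Measurable α) {β : X → κ}
    (h : ∀ x y, α x = α y → β x = β y) : partitionEntropy μ β ≤ partitionEntropy μ α := by
  obtain ⟨x₀⟩ : Nonempty X := nonempty_of_isProbabilityMeasure μ
  refine partitionEntropy_le_of_factor hα (Function.extend α β fun _ => β x₀) fun x => ?_
  exact (Function.FactorsThrough.extend_apply (fun x y hxy => h x y hxy) _ x).symm

/-- Strong subadditivity, `H(α ∨ β | γ) ≤ H(α | γ) + H(β | γ)`, written without conditional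
entropies. -/
lemma partitionEntropy_strong_subadditive {α : X → ι} {β : X → κ} {γ : X → τ}
    (hα : Measurable α) (hβ : Measurable β) (hγ : Measurable γ) :
    partitionEntropy μ (fun x => (α x, β x, γ x)) + partitionEntropy μ γ ≤
      partitionEntropy μ (fun x => (α x, γ x)) + partitionEntropy μ (fun x => (β x, γ x)) := by
  classical
  set r : ι → κ → τ → ℝ := fun i j k => μ.real (α ⁻¹' {i} ∩ β ⁻¹' {j} ∩ γ ⁻¹' {k}) with hr
  set p : ι → τ → ℝ := fun i k => μ.real (α ⁻¹' {i} ∩ γ ⁻¹' {k}) with hp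
  set q : κ → τ → ℝ := fun j k => μ.real (β ⁻¹' {j} ∩ γ ⁻¹' {k}) with hq
  set s : τ → ℝ := fun k => μ.real (γ ⁻¹' {k}) with hs
  have mα := fun i => hα (measurableSet_singleton i)
  have mβ := fun j => hβ (measurableSet_singleton j)
  have mγ := fun k => hγ (measurableSet_singleton k)
  have hrp : ∀ i k, ∑ j, r i j k = p i k := by
    intro i k
    have := sum_fiber (μ := μ) hβ ((mα i).inter (mγ k))
    refine Eq.trans ?_ this
    refine Finset.sum_congr rfl fun j _ => ?_
    rw [hr]
    dsimp only
    rw [Set.inter_right_comm]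
  have hrq : ∀ j k, ∑ i, r i j k = q j k := by
    intro j k
    have := sum_fiber (μ := μ) hα ((mβ j).inter (mγ k))
    refine Eq.trans ?_ this
    refine Finset.sum_congr rfl fun i _ => ?_
    rw [hr]
    dsimp only
    rw [Set.inter_comm _ (α ⁻¹' {i}), Set.inter_assoc]
  have hps : ∀ k, ∑ i, p i k = s k := by
    intro k
    have := sum_fiber (μ := μ) hα (mγ k)
    simpa only [hp, Set.inter_comm] using this
  have hqs : ∀ k, ∑ j, q j k = s k := by
    intro k
    have := sum_fiber (μ := μ) hβ (mγ k)
    simpa only [hq, Set.inter_comm] using this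
  have hs1 : ∑ k, s k = 1 := by
    have := sum_fiber (μ := μ) hγ MeasurableSet.univ
    simpa [hs] using this
  have hr0 : ∀ i j k, 0 ≤ r i j k := fun i j k => measureReal_nonneg
  have hle1 : ∀ i j k, r i j k ≤ p i k := fun i j k =>
    measureReal_mono (Set.inter_subset_inter_left _ Set.inter_subset_left)
  have hle2 : ∀ i j k, r i j k ≤ q j k := fun i j k =>
    measureReal_mono (Set.inter_subset_inter_left _ Set.inter_subset_right)
  have hle3 : ∀ i j k, r i j k ≤ s k := fun i j k => measureReal_mono Set.inter_subset_right
  -- The term-by-term bound is `log t ≤ t - 1` at `t = p q / (r s)`.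
  have key : ∀ i j k, Real.negMulLog (r i j k) ≤
      -(r i j k * Real.log (p i k)) - r i j k * Real.log (q j k) + r i j k * Real.log (s k)
        + (p i k * q j k / s k - r i j k) := by
    intro i j k
    rcases (hr0 i j k).eq_or_lt with h | h
    · rw [← h]
      simp only [Real.negMulLog_zero, zero_mul, neg_zero, sub_zero, zero_add]
      exact div_nonneg (mul_nonneg measureReal_nonneg measureReal_nonneg) measureReal_nonneg
    · have hpi : 0 < p i k := h.trans_le (hle1 i j k)
      have hqj : 0 < q j k := h.trans_le (hle2 i j k)
      have hsk : 0 < s k := h.trans_le (hle3 i j k)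
      have hl := Real.log_le_sub_one_of_pos (div_pos (mul_pos hpi hqj) (mul_pos h hsk))
      rw [Real.log_div (mul_pos hpi hqj).ne' (mul_pos h hsk).ne', Real.log_mul hpi.ne' hqj.ne',
        Real.log_mul h.ne' hsk.ne'] at hl
      have h2 := mul_le_mul_of_nonneg_left hl h.le
      have h3 : r i j k * (p i k * q j k / (r i j k * s k) - 1)
          = p i k * q j k / s k - r i j k := by field_simp
      rw [h3] at h2
      rw [Real.negMulLog]
      linarith
  have e1 : partitionEntropy μ (fun x => (α x, β x, γ x))
      = ∑ k, ∑ i, ∑ j, Real.negMulLog (r i j k) := by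
    rw [partitionEntropy, Fintype.sum_prod_type, Finset.sum_comm]
    rw [Fintype.sum_prod_type, Finset.sum_comm]
    refine Finset.sum_congr rfl fun k _ => ?_
    rw [Finset.sum_comm]
    refine Finset.sum_congr rfl fun i _ => Finset.sum_congr rfl fun j _ => ?_
    congr 2
    ext x
    simp [and_assoc]
  have e2 : ∑ k, ∑ i, ∑ j, r i j k * Real.log (p i k)
      = -partitionEntropy μ (fun x => (α x, γ x)) := by
    rw [partitionEntropy, Fintype.sum_prod_type, Finset.sum_comm, ← Finset.sum_neg_distrib]
    refine Finset.sum_congr rfl fun i _ => ?_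
    rw [← Finset.sum_neg_distrib]
    refine Finset.sum_congr rfl fun k _ => ?_
    rw [← Finset.sum_mul, hrp, Real.negMulLog, neg_mul, neg_neg]
    have : (fun x => (α x, γ x)) ⁻¹' {(i, k)} = α ⁻¹' {i} ∩ γ ⁻¹' {k} := by
      ext x
      simp
    rw [this]
  have e3 : ∑ k, ∑ i, ∑ j, r i j k * Real.log (q j k)
      = -partitionEntropy μ (fun x => (β x, γ x)) := by
    rw [partitionEntropy, Fintype.sum_prod_type, Finset.sum_comm (s := (Finset.univ : Finset κ)),
      ← Finset.sum_neg_distrib]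
    refine Finset.sum_congr rfl fun k _ => ?_
    rw [← Finset.sum_neg_distrib, Finset.sum_comm]
    refine Finset.sum_congr rfl fun j _ => ?_
    rw [← Finset.sum_mul, hrq, Real.negMulLog, neg_mul, neg_neg]
    have : (fun x => (β x, γ x)) ⁻¹' {(j, k)} = β ⁻¹' {j} ∩ γ ⁻¹' {k} := by
      ext x
      simp
    rw [this]
  have e4 : ∑ k, ∑ i, ∑ j, r i j k * Real.log (s k) = -partitionEntropy μ γ := by
    rw [partitionEntropy, ← Finset.sum_neg_distrib]
    refine Finset.sum_congr rfl fun k _ => ?_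
    simp_rw [← Finset.sum_mul, hrp, hps]
    rw [Real.negMulLog, neg_mul, neg_neg]
  have e5 : ∑ k, ∑ i, ∑ j, p i k * q j k / s k = 1 := by
    rw [← hs1]
    refine Finset.sum_congr rfl fun k _ => ?_
    simp_rw [← Finset.sum_div, ← Finset.mul_sum, hqs, ← Finset.sum_mul, hps]
    exact mul_self_div_self _
  have e6 : ∑ k, ∑ i, ∑ j, r i j k = 1 := by simp_rw [hrp, hps, hs1]
  have := Finset.sum_le_sum fun k (_ : k ∈ Finset.univ) =>
    Finset.sum_le_sum fun i (_ : i ∈ Finset.univ) =>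
    Finset.sum_le_sum fun j (_ : j ∈ Finset.univ) => key i j k
  simp only [Finset.sum_add_distrib, Finset.sum_sub_distrib, Finset.sum_neg_distrib] at this
  rw [e2, e3, e4, e5, e6] at this
  rw [e1]
  linarith

lemma refinement_eq_iff {T : X → X} {α : X → ι} {n : ℕ} {x y : X} :
    refinement T α n x = refinement T α n y ↔ ∀ i < n, α (T^[i] x) = α (T^[i] y) := by
  simp [refinement, funext_iff, Fin.forall_iff]

lemma partitionEntropy_comp_iterate {T : X → X} (hT : MeasurePreserving T μ μ) {α : X → ι}
    (hα : Measurable α) (n : ℕ) :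
    partitionEntropy μ (fun x => α (T^[n] x)) = partitionEntropy μ α := by
  refine Finset.sum_congr rfl fun i _ => ?_
  congr 1
  exact (hT.iterate n).measureReal_preimage (hα (measurableSet_singleton i)).nullMeasurableSet

lemma partitionEntropy_refinement_le {T : X → X} (hT : MeasurePreserving T μ μ) {α : X → ι}
    (hα : Measurable α) (n : ℕ) :
    partitionEntropy μ (refinement T α n) ≤ n * partitionEntropy μ α := by
  induction n with
  | zero =>
    have h : ∀ i, refinement T α 0 ⁻¹' {i} = Set.univ := fun i =>
      Set.eq_univ_of_forall fun x => Subsingleton.elim _ _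
    simp [partitionEntropy, h]
  | succ n ih =>
    have h1 := subadditive_refinement hT hα n 1
    have h2 : partitionEntropy μ (refinement T α 1) ≤ partitionEntropy μ α :=
      partitionEntropy_le_of_determined hα fun x y hxy => refinement_eq_iff.2 fun i hi => by
        obtain rfl : i = 0 := by omega
        exact hxy
    push_cast
    simp only at h1
    linarith

/-! ### Entropy of tail sets -/

/-- Block entropies have nonincreasing increments. -/
lemma refinement_concave {T : X → X} (hT : MeasurePreserving T μ μ) {α : X → ι}
    (hα : Measurable α) (m : ℕ) :
    partitionEntropy μ (refinement T α (m + 2)) + partitionEntropy μ (refinement T α m) ≤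
      2 * partitionEntropy μ (refinement T α (m + 1)) := by
  have hm := measurable_refinement hT.measurable hα m
  have hm1 := measurable_refinement hT.measurable hα (m + 1)
  have hγ : Measurable fun x => refinement T α m (T^[1] x) := hm.comp (hT.iterate 1).measurable
  have hβ : Measurable fun x => α (T^[m + 1] x) := hα.comp (hT.iterate (m + 1)).measurable
  have h := partitionEntropy_strong_subadditive (μ := μ) hα hβ hγ
  have e0 := partitionEntropy_comp_iterate hT hm 1
  have e1 : partitionEntropy μ (refinement T α (m + 2)) ≤ partitionEntropy μ
      (fun x => (α x, α (T^[m + 1] x), refinement T α m (T^[1] x))) := by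
    refine partitionEntropy_le_of_determined (hα.prodMk (hβ.prodMk hγ)) fun x y hxy => ?_
    simp only [Prod.mk.injEq, refinement_eq_iff, ← Function.iterate_add_apply] at hxy
    refine refinement_eq_iff.2 fun i hi => ?_
    obtain rfl | rfl | ⟨k, rfl, hk⟩ : i = 0 ∨ i = m + 1 ∨ ∃ k, i = k + 1 ∧ k < m := by
      rcases i with _ | i
      · simp
      · rcases eq_or_ne i m with rfl | h
        · simp
        · exact Or.inr (Or.inr ⟨i, rfl, by omega⟩)
    · exact hxy.1
    · exact hxy.2.1
    · exact hxy.2.2 k hk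
  have e2 : partitionEntropy μ (fun x => (α x, refinement T α m (T^[1] x))) ≤
      partitionEntropy μ (refinement T α (m + 1)) := by
    refine partitionEntropy_le_of_determined hm1 fun x y hxy => ?_
    rw [refinement_eq_iff] at hxy
    simp only [Prod.mk.injEq, refinement_eq_iff, ← Function.iterate_add_apply]
    exact ⟨hxy 0 (by omega), fun i hi => hxy (i + 1) (by omega)⟩
  have e3 : partitionEntropy μ (fun x => (α (T^[m + 1] x), refinement T α m (T^[1] x))) ≤
      partitionEntropy μ (refinement T α (m + 1)) := by
    rw [← partitionEntropy_comp_iterate hT hm1 1]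
    refine partitionEntropy_le_of_determined (hm1.comp (hT.iterate 1).measurable)
      fun x y hxy => ?_
    simp only [Function.comp_apply, refinement_eq_iff, ← Function.iterate_add_apply] at hxy
    simp only [Prod.mk.injEq, refinement_eq_iff, ← Function.iterate_add_apply]
    exact ⟨hxy m (by omega), fun i hi => hxy i (by omega)⟩
  linarith

/-- A concave sequence growing at rate `h` has all increments at least `h`. -/
lemma mul_le_sub_of_concave {c : ℕ → ℝ} (hc : ∀ m, c (m + 2) + c m ≤ 2 * c (m + 1)) {h : ℝ}
    (hlim : Tendsto (fun n : ℕ => c n / n) atTop (𝓝 h)) (m n : ℕ) :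
    n * h ≤ c (m + n) - c m := by
  have anti : Antitone fun m => c (m + 1) - c m :=
    antitone_nat_of_succ_le fun m => by
      have := hc m
      change c (m + 2) - c (m + 1) ≤ c (m + 1) - c m
      linarith
  have upper : ∀ m n, c (m + n) ≤ c m + n * (c (m + 1) - c m) := by
    intro m n
    induction n with
    | zero => simp
    | succ n ih =>
      have h1 : c (m + n + 1) - c (m + n) ≤ c (m + 1) - c m := anti (by omega : m ≤ m + n)
      rw [← add_assoc]
      push_cast
      linarith
  have hle : ∀ m, h ≤ c (m + 1) - c m := by
    intro m
    have t1 := (tendsto_add_atTop_iff_nat m).2 hlim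
    have t2 : Tendsto (fun n : ℕ => (c m + n * (c (m + 1) - c m)) / (n + m : ℕ)) atTop
        (𝓝 (c (m + 1) - c m)) := by
      have i1 : Tendsto (fun n : ℕ => ((n + m : ℕ) : ℝ)⁻¹) atTop (𝓝 0) :=
        (tendsto_add_atTop_iff_nat m).2 tendsto_inv_atTop_nhds_zero_nat
      have i2 := (i1.mul_const (c m - m * (c (m + 1) - c m))).add_const (c (m + 1) - c m)
      rw [zero_mul, zero_add] at i2
      refine i2.congr' ?_
      filter_upwards [eventually_gt_atTop 0] with n hn
      have : ((n + m : ℕ) : ℝ) ≠ 0 := by positivity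
      field_simp
      push_cast
      ring
    refine le_of_tendsto_of_tendsto' t1 t2 fun n => ?_
    refine div_le_div_of_nonneg_right ?_ (Nat.cast_nonneg _)
    rw [add_comm n m]
    exact upper m n
  induction n with
  | zero => simp
  | succ n ih =>
    have := hle (m + n)
    rw [← add_assoc]
    push_cast
    linarith

lemma exists_forall_partitionEntropy_twoSet_lt (μ : Measure X) [IsProbabilityMeasure μ] {ε : ℝ}
    (hε : 0 < ε) :
    ∃ δ > 0, ∀ D : Set X, MeasurableSet D → μ.real D < δ →
      partitionEntropy μ (twoSet D) < ε := by
  have c : Continuous fun t : ℝ => Real.negMulLog t + Real.negMulLog (1 - t) := by fun_prop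
  have h0 := c.tendsto 0
  simp only [Real.negMulLog_zero, sub_zero, Real.negMulLog_one, add_zero] at h0
  obtain ⟨δ, hδ, h⟩ := Metric.mem_nhds_iff.1 (h0.eventually (gt_mem_nhds hε))
  refine ⟨δ, hδ, fun D hD hlt => ?_⟩
  rw [partitionEntropy_twoSet hD]
  refine h (a := μ.real D) ?_
  rw [mem_ball_zero_iff, Real.norm_of_nonneg measureReal_nonneg]
  exact hlt

/-- Adjoining `n` translates of `A` to a partition `ζ` that knows the translates of `B` costs at
most `n` times the entropy of the error `A ∆ B`. -/
lemma partitionEntropy_prod_refinement_le {T : X → X} (hT : MeasurePreserving T μ μ)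
    {A B : Set X} (hA : MeasurableSet A) (hB : MeasurableSet B) {n : ℕ} {ζ : X → κ}
    (hζ : Measurable ζ)
    (h : ∀ x y, ζ x = ζ y → ∀ i < n, (T^[i] x ∈ B ↔ T^[i] y ∈ B)) :
    partitionEntropy μ (fun x => (ζ x, refinement T (twoSet A) n x)) ≤
      partitionEntropy μ ζ + n * partitionEntropy μ (twoSet (symmDiff A B)) := by
  have hD := measurable_twoSet (hA.symmDiff hB)
  have hR := measurable_refinement hT.measurable hD n
  refine (partitionEntropy_le_of_determined (hζ.prodMk hR) fun x y hxy => ?_).trans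
    ((partitionEntropy_pair_le hζ hR).trans
      (add_le_add le_rfl (partitionEntropy_refinement_le hT hD n)))
  simp only [Prod.mk.injEq, refinement_eq_iff] at hxy ⊢
  refine ⟨hxy.1, fun i hi => ?_⟩
  have h1 := hxy.2 i hi
  have h2 := h x y hxy.1 i hi
  simp only [twoSet, Set.mem_symmDiff, eq_iff_iff] at h1 ⊢
  tauto

/-- A set which is, for every `n`, approximable by sets depending on finitely many of the
coordinates `α ∘ Tⁱ`, `i ≥ n`, has zero entropy. -/
theorem entropy_twoSet_eq_zero_of_approx {T : X → X} (hT : MeasurePreserving T μ μ) {α : X → ι}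
    (hα : Measurable α) {A : Set X} (hA : MeasurableSet A)
    (happ : ∀ n : ℕ, ∀ δ > 0, ∃ M : ℕ, ∃ B : Set X, MeasurableSet B ∧
      (∀ x y, (∀ i < M, α (T^[n + i] x) = α (T^[n + i] y)) → (x ∈ B ↔ y ∈ B)) ∧
      μ.real (symmDiff A B) < δ) :
    entropy μ T (twoSet A) = 0 := by
  set c : ℕ → ℝ := fun n => partitionEntropy μ (refinement T α n) with hc
  have mα := fun n => measurable_refinement hT.measurable hα n
  have mA := fun n => measurable_refinement hT.measurable (measurable_twoSet hA) n
  have hclim : Tendsto (fun n : ℕ => c n / n) atTop (𝓝 (entropy μ T α)) := tendsto_entropy hT hα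
  refine le_antisymm (le_of_forall_pos_le_add fun ε hε => ?_)
    (entropy_nonneg hT (measurable_twoSet hA))
  obtain ⟨δ, hδ, hsmall⟩ := exists_forall_partitionEntropy_twoSet_lt μ (half_pos hε)
  obtain ⟨M, B, hB, hBdet, hAB⟩ := happ 0 δ hδ
  have hAB' := hsmall _ (hA.symmDiff hB) hAB
  have bound : ∀ n : ℕ, partitionEntropy μ (refinement T (twoSet A) n) ≤
      n * ε + c M + (c n - n * entropy μ T α) := by
    intro n
    obtain ⟨M', B', hB', hBdet', hAB2⟩ := happ n δ hδ
    have hAB2' := hsmall _ (hA.symmDiff hB') hAB2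
    set ζ : X → (Fin (M' + n) → ι) := fun x => refinement T α (M' + n) (T^[n] x) with hζ
    have mζ : Measurable ζ := (mα _).comp (hT.iterate n).measurable
    have eζ : partitionEntropy μ ζ = c (M' + n) := partitionEntropy_comp_iterate hT (mα _) n
    -- `ζ` is the block `α_n^{n + M' + n}`, long enough to determine all `T⁻ⁱ B'` with `i < n`.
    have h1 := partitionEntropy_strong_subadditive (μ := μ) (mα n) mζ (mA n)
    have h2 : c (M' + n + n) ≤ partitionEntropy μ
        (fun x => (refinement T α n x, ζ x, refinement T (twoSet A) n x)) := by
      refine partitionEntropy_le_of_determined ((mα n).prodMk (mζ.prodMk (mA n)))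
        fun x y hxy => ?_
      simp only [Prod.mk.injEq, hζ, refinement_eq_iff, ← Function.iterate_add_apply] at hxy
      refine refinement_eq_iff.2 fun i hi => ?_
      by_cases hin : i < n
      · exact hxy.1 i hin
      · have := hxy.2.1 (i - n) (by omega)
        rwa [Nat.sub_add_cancel (by omega)] at this
    have h3 : partitionEntropy μ (fun x => (refinement T α n x, refinement T (twoSet A) n x)) ≤
        c n + c M + n * (ε / 2) := by
      have s1 : partitionEntropy μ
          (fun x => (refinement T α n x, refinement T (twoSet A) n x)) ≤
          partitionEntropy μ (fun x => (refinement T α (n + M) x, refinement T (twoSet A) n x)) :=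
        partitionEntropy_le_of_determined ((mα (n + M)).prodMk (mA n)) fun x y hxy => by
          simp only [Prod.mk.injEq] at hxy ⊢
          refine ⟨?_, hxy.2⟩
          have := refinement_eq_iff.1 hxy.1
          exact refinement_eq_iff.2 fun i hi => this i (by omega)
      have s2 := partitionEntropy_prod_refinement_le (μ := μ) hT hA hB (n := n) (mα (n + M))
        fun x y hxy i hi => hBdet _ _ fun j hj => by
          rw [refinement_eq_iff] at hxy
          rw [← Function.iterate_add_apply, ← Function.iterate_add_apply]
          exact hxy _ (by omega)
      have s3 : c (n + M) ≤ c n + c M := subadditive_refinement hT hα n M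
      have s4 := mul_le_mul_of_nonneg_left hAB'.le (Nat.cast_nonneg (α := ℝ) n)
      linarith
    have h4 : partitionEntropy μ (fun x => (ζ x, refinement T (twoSet A) n x)) ≤
        c (M' + n) + n * (ε / 2) := by
      have s2 := partitionEntropy_prod_refinement_le (μ := μ) hT hA hB' (n := n) mζ
        fun x y hxy i hi => hBdet' _ _ fun j hj => by
          simp only [hζ, refinement_eq_iff, ← Function.iterate_add_apply] at hxy
          rw [← Function.iterate_add_apply, ← Function.iterate_add_apply]
          have := hxy (j + i) (by omega)
          rwa [show j + i + n = n + j + i by omega] at this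
      have s4 := mul_le_mul_of_nonneg_left hAB2'.le (Nat.cast_nonneg (α := ℝ) n)
      linarith
    have h5 := mul_le_sub_of_concave (fun m => refinement_concave hT hα m) hclim (M' + n) n
    simp only [hc] at *
    linarith
  have lim : Tendsto (fun n : ℕ => ε + c M * (n : ℝ)⁻¹ + (c n / n - entropy μ T α)) atTop
      (𝓝 (ε + c M * 0 + (entropy μ T α - entropy μ T α))) :=
    ((tendsto_inv_atTop_nhds_zero_nat.const_mul _).const_add _).add (hclim.sub_const _)
  rw [mul_zero, sub_self, add_zero, add_zero] at lim
  rw [zero_add]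
  refine le_of_tendsto_of_tendsto (tendsto_entropy hT (measurable_twoSet hA)) lim ?_
  filter_upwards [eventually_gt_atTop 0] with n hn
  have hn' : (0 : ℝ) < n := Nat.cast_pos.2 hn
  rw [div_le_iff₀ hn']
  refine (bound n).trans_eq ?_
  field_simp

/-! ### The future of a finite partition and the Pinsker σ-algebra -/

/-- The σ-algebra generated by the functions `α ∘ Tⁱ`, `i ≥ n`, as the pullback of the product
σ-algebra under the coding map `x ↦ (α (Tⁿ⁺ⁱ x))ᵢ`. -/
@[reducible]
def futureAlgebra (T : X → X) (α : X → ι) (n : ℕ) : MeasurableSpace X :=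
  MeasurableSpace.comap (fun (x : X) (i : ℕ) => α (T^[n + i] x)) MeasurableSpace.pi

lemma measurable_coding {T : X → X} (hT : Measurable T) {α : X → ι} (hα : Measurable α) (n : ℕ) :
    Measurable fun (x : X) (i : ℕ) => α (T^[n + i] x) :=
  measurable_pi_lambda _ fun i => hα.comp (hT.iterate (n + i))

lemma futureAlgebra_le {T : X → X} (hT : Measurable T) {α : X → ι} (hα : Measurable α) (n : ℕ) :
    futureAlgebra T α n ≤ ‹MeasurableSpace X› :=
  (measurable_coding hT hα n).comap_le

lemma futureAlgebra_antitone (T : X → X) (α : X → ι) : Antitone (futureAlgebra T α) := by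
  intro m n hmn
  obtain ⟨k, rfl⟩ := Nat.exists_eq_add_of_le hmn
  have h : Measurable fun (ω : ℕ → ι) (i : ℕ) => ω (k + i) :=
    measurable_pi_lambda _ fun i => measurable_pi_apply _
  calc futureAlgebra T α (m + k)
      = MeasurableSpace.comap (fun (x : X) (i : ℕ) => α (T^[m + i] x))
          (MeasurableSpace.comap (fun (ω : ℕ → ι) (i : ℕ) => ω (k + i)) MeasurableSpace.pi) := by
        rw [MeasurableSpace.comap_comp]
        simp only [futureAlgebra, Function.comp_def, add_assoc]
    _ ≤ futureAlgebra T α m := MeasurableSpace.comap_mono h.comap_le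

lemma measurable_futureAlgebra (T : X → X) (α : X → ι) (n : ℕ) :
    Measurable[futureAlgebra T α n] fun x => α (T^[n] x) :=
  (measurable_pi_apply (X := fun _ : ℕ => ι) 0).comp
    (comap_measurable fun (x : X) (i : ℕ) => α (T^[n + i] x))

/-- Sets in the future of `α` are approximated by sets depending on finitely many coordinates. -/
lemma exists_approx_of_measurableSet_futureAlgebra {T : X → X} (hT : Measurable T) {α : X → ι}
    (hα : Measurable α) {n : ℕ} {A : Set X} (hA : MeasurableSet[futureAlgebra T α n] A) {δ : ℝ}
    (hδ : 0 < δ) :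
    ∃ M : ℕ, ∃ B : Set X, MeasurableSet B ∧
      (∀ x y, (∀ i < M, α (T^[n + i] x) = α (T^[n + i] y)) → (x ∈ B ↔ y ∈ B)) ∧
      μ.real (symmDiff A B) < δ := by
  obtain ⟨C, hC, rfl⟩ := hA
  have hΨ := measurable_coding hT hα n
  set Ψ : X → ℕ → ι := fun x i => α (T^[n + i] x) with hΨdef
  have hdense := Measure.MeasureDense.of_generateFrom_isSetAlgebra_finite (μ := μ.map Ψ)
    (isSetAlgebra_measurableCylinders (α := fun _ : ℕ => ι)) generateFrom_measurableCylinders.symm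
  obtain ⟨t, ht, hCt⟩ := hdense.approx C hC (measure_ne_top _ _) δ hδ
  have htm : MeasurableSet t := hdense.measurable t ht
  obtain ⟨s, S, hS, rfl⟩ := (mem_measurableCylinders t).1 ht
  refine ⟨s.sup id + 1, Ψ ⁻¹' cylinder s S, hΨ htm, fun x y hxy => ?_, ?_⟩
  · have : s.restrict (Ψ x) = s.restrict (Ψ y) := by
      funext i
      exact hxy i (Nat.lt_succ_of_le (Finset.le_sup (f := id) i.2))
    simp only [Set.mem_preimage, mem_cylinder, this]
  · rw [Measure.map_apply hΨ (hC.symmDiff htm), Set.preimage_symmDiff] at hCt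
    rw [measureReal_def]
    exact (ENNReal.lt_ofReal_iff_toReal_lt (measure_ne_top _ _)).1 hCt

/-- The tail of the future of a finite partition is contained in the Pinsker σ-algebra, up to null
sets. -/
theorem measurableSet_pinsker_of_forall_ae_eq {T : X → X} (hT : MeasurePreserving T μ μ)
    {α : X → ι} (hα : Measurable α) {A : Set X} (hA : MeasurableSet A)
    (h : ∀ n, ∃ A', MeasurableSet[futureAlgebra T α n] A' ∧ A =ᵐ[μ] A') :
    MeasurableSet[pinsker μ hT] A := by
  refine ⟨hA, entropy_twoSet_eq_zero_of_approx hT hα hA fun n δ hδ => ?_⟩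
  obtain ⟨A', hA', hAA'⟩ := h n
  obtain ⟨M, B, hB, hdet, hlt⟩ :=
    exists_approx_of_measurableSet_futureAlgebra (μ := μ) hT.measurable hα hA' hδ
  refine ⟨M, B, hB, hdet, ?_⟩
  rwa [measureReal_congr (hAA'.symmDiff (ae_eq_refl (B : Set X)))]

variable {𝕜 : Type*} [RCLike 𝕜]

/-- Each level set of a function measurable in the tail up to null sets lies in the Pinsker
σ-algebra; no common tail-measurable representative is needed, since that σ-algebra contains the
measurable null sets. -/
lemma iInf_lpMeas_futureAlgebra_le {T : X → X} (hT : MeasurePreserving T μ μ) {α : X → ι}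
    (hα : Measurable α) :
    ⨅ n, lpMeas 𝕜 𝕜 (futureAlgebra T α n) 2 μ ≤ lpMeas 𝕜 𝕜 (pinsker μ hT) 2 μ := by
  intro f hf
  rw [Submodule.mem_iInf] at hf
  rw [mem_lpMeas_iff_aestronglyMeasurable]
  have hm : Measurable[pinsker μ hT] (f : X → 𝕜) := by
    intro C hC
    refine measurableSet_pinsker_of_forall_ae_eq hT hα
      ((Lp.stronglyMeasurable f).measurable hC) fun n => ?_
    obtain ⟨g, hg, hfg⟩ := mem_lpMeas_iff_aestronglyMeasurable.1 (hf n)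
    exact ⟨g ⁻¹' C, hg.measurable hC, hfg.preimage C⟩
  exact ⟨f, hm.stronglyMeasurable, ae_eq_refl _⟩

lemma pinsker_le {T : X → X} (hT : MeasurePreserving T μ μ) :
    pinsker μ hT ≤ ‹MeasurableSpace X› := fun _ hA => hA.1

/-! ### Mixing of isometries on a Hilbert space -/

section Hilbert

variable {H : Type*} [NormedAddCommGroup H] [InnerProductSpace 𝕜 H]

/-- A vector orthogonal to the intersection of decreasing closed subspaces is nearly orthogonal to
one of them. -/
lemma exists_near_of_mem_orthogonal_iInf [CompleteSpace H] {K : ℕ → Submodule 𝕜 H}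
    (hK : Antitone K) (hc : ∀ n, IsClosed (K n : Set H)) {g : H} (hg : g ∈ (⨅ n, K n)ᗮ) {ε : ℝ}
    (hε : 0 < ε) : ∃ n, ∃ g' ∈ (K n)ᗮ, ‖g - g'‖ < ε := by
  have e : ⨅ n, K n = (⨆ n, (K n)ᗮ)ᗮ := by
    rw [← Submodule.iInf_orthogonal]
    refine iInf_congr fun n => ?_
    rw [Submodule.orthogonal_orthogonal_eq_closure, (hc n).submodule_topologicalClosure_eq]
  rw [e, Submodule.orthogonal_orthogonal_eq_closure, ← SetLike.mem_coe,
    Submodule.topologicalClosure_coe] at hg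
  obtain ⟨g', hg', hlt⟩ := Metric.mem_closure_iff.1 hg ε hε
  have hmono : Monotone fun n => (K n)ᗮ := fun m n hmn => Submodule.orthogonal_le (hK hmn)
  obtain ⟨n, hn⟩ := (Submodule.mem_iSup_of_directed _ hmono.directed_le).1 hg'
  exact ⟨n, g', hn, by rwa [← dist_eq_norm]⟩

/-- If `g` is a limit of vectors `f` whose orbit `U n f` sinks into decreasing closed subspaces
`K n` with intersection orthogonal to `g`, then the correlations of `g` tend to `0`. -/
theorem tendsto_inner_of_approx [CompleteSpace H] (U : ℕ → H →ₗᵢ[𝕜] H) {g : H}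
    (h : ∀ ε > 0, ∃ f, ‖g - f‖ < ε ∧ ∃ K : ℕ → Submodule 𝕜 H, Antitone K ∧
      (∀ n, IsClosed (K n : Set H)) ∧ (∀ n, U n f ∈ K n) ∧ g ∈ (⨅ n, K n)ᗮ) :
    Tendsto (fun n => inner 𝕜 (U n g) g) atTop (𝓝 0) := by
  rw [Metric.tendsto_atTop]
  intro ε hε
  obtain ⟨η, hη, hη1, hηε⟩ : ∃ η > 0, η ≤ 1 ∧ η * (2 * ‖g‖ + 1) < ε := by
    refine ⟨min 1 (ε / (2 * (2 * ‖g‖ + 1))), by positivity, min_le_left _ _, ?_⟩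
    refine (mul_le_mul_of_nonneg_right (min_le_right _ _) (by positivity)).trans_lt ?_
    have : ε / (2 * (2 * ‖g‖ + 1)) * (2 * ‖g‖ + 1) = ε / 2 := by field_simp
    linarith
  obtain ⟨f, hf, K, hK, hc, hUK, hg⟩ := h η hη
  obtain ⟨n, g', hg', hgg'⟩ := exists_near_of_mem_orthogonal_iInf hK hc hg hη
  refine ⟨n, fun m hm => ?_⟩
  have h0 : inner 𝕜 (U m f) g' = 0 :=
    Submodule.inner_right_of_mem_orthogonal (hK hm (hUK m)) hg'
  -- Replace `g` by `f` on the left, then by `g'` on the right, where the correlation vanishes.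
  have e : inner 𝕜 (U m g) g = inner 𝕜 (U m (g - f)) g + inner 𝕜 (U m f) (g - g') := by
    rw [map_sub, inner_sub_left, inner_sub_right, h0]
    ring
  have hfn : ‖f‖ ≤ ‖g‖ + η := by
    have := norm_sub_norm_le f g
    rw [norm_sub_rev] at this
    linarith
  rw [dist_zero_right, e]
  calc ‖inner 𝕜 (U m (g - f)) g + inner 𝕜 (U m f) (g - g')‖
      ≤ ‖U m (g - f)‖ * ‖g‖ + ‖U m f‖ * ‖g - g'‖ :=
        (norm_add_le _ _).trans (add_le_add (norm_inner_le_norm _ _) (norm_inner_le_norm _ _))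
    _ ≤ η * ‖g‖ + (‖g‖ + η) * η := by
        rw [LinearIsometry.norm_map, LinearIsometry.norm_map]
        gcongr
    _ ≤ η * (2 * ‖g‖ + 1) := by nlinarith
    _ < ε := hηε

lemma norm_inner_map_map_eq (U : ℕ → H →ₗᵢ[𝕜] H) (hU : ∀ m n x, U (m + n) x = U m (U n x)) (g : H)
    (p q : ℕ) : ‖inner 𝕜 (U p g) (U q g)‖ = ‖inner 𝕜 (U (Nat.dist p q) g) g‖ := by
  wlog hpq : q ≤ p generalizing p q
  · rw [norm_inner_symm, this q p (by omega), Nat.dist_comm]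
  · obtain ⟨k, rfl⟩ := Nat.exists_eq_add_of_le hpq
    rw [hU, LinearIsometry.inner_map_map, Nat.dist_eq_sub_of_le_right hpq, Nat.add_sub_cancel_left]

/-- Expanding `‖∑ U^{a k} g‖²` into correlations, condition (∗) leaves only pairs with a large gap
`|a i - a j|`, whose correlation is small. -/
theorem tendsto_norm_average (U : ℕ → H →ₗᵢ[𝕜] H) (hU : ∀ m n x, U (m + n) x = U m (U n x))
    {g : H} (hmix : Tendsto (fun n => inner 𝕜 (U n g) g) atTop (𝓝 0)) {a : ℕ → ℕ}
    (ha : ConditionStar a) :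
    Tendsto (fun N : ℕ => ‖(N : 𝕜)⁻¹ • ∑ k ∈ Finset.Icc 1 N, U (a k) g‖) atTop (𝓝 0) := by
  suffices hsq : Tendsto
      (fun N : ℕ => ‖(N : 𝕜)⁻¹ • ∑ k ∈ Finset.Icc 1 N, U (a k) g‖ ^ 2) atTop (𝓝 0) by
    have := hsq.sqrt
    rw [Real.sqrt_zero] at this
    exact this.congr fun N => Real.sqrt_sq (norm_nonneg _)
  rw [Metric.tendsto_atTop]
  intro ε hε
  have hmix' := hmix.norm
  rw [norm_zero] at hmix'
  obtain ⟨n₀, hn₀⟩ := eventually_atTop.1 (hmix'.eventually (gt_mem_nhds (half_pos hε)))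
  have hstar := (ha (n₀ + 1) (by positivity)).const_mul (‖g‖ ^ 2)
  rw [mul_zero] at hstar
  obtain ⟨N₀, hN₀⟩ := eventually_atTop.1 (hstar.eventually (gt_mem_nhds (half_pos hε)))
  refine ⟨max N₀ 1, fun N hN => ?_⟩
  have hNpos : (0 : ℝ) < N := Nat.cast_pos.2 (by omega)
  have hlt := hN₀ N (le_of_max_le_left hN)
  set Q := Finset.Icc 1 N ×ˢ Finset.Icc 1 N with hQ
  set near := Q.filter (fun p : ℕ × ℕ => |(a p.1 : ℝ) - (a p.2 : ℝ)| ≤ n₀ + 1) with hnear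
  have hQcard : (Q.card : ℝ) = (N : ℝ) ^ 2 := by
    rw [hQ, Finset.card_product, Nat.card_Icc]
    push_cast
    simp [sq]
  have pair : ∀ p ∈ Q, ‖inner 𝕜 (U (a p.1) g) (U (a p.2) g)‖ ≤
      ε / 2 + if |(a p.1 : ℝ) - (a p.2 : ℝ)| ≤ n₀ + 1 then ‖g‖ ^ 2 else 0 := by
    intro p _
    split_ifs with hp
    · have := norm_inner_le_norm (𝕜 := 𝕜) (U (a p.1) g) (U (a p.2) g)
      rw [LinearIsometry.norm_map, LinearIsometry.norm_map] at this
      linarith [sq ‖g‖]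
    · rw [norm_inner_map_map_eq U hU, add_zero]
      refine (hn₀ _ ?_).le
      by_contra hlt'
      refine hp ?_
      have h1 : a p.1 ≤ a p.2 + (n₀ + 1) := by
        unfold Nat.dist at hlt'
        omega
      have h2 : a p.2 ≤ a p.1 + (n₀ + 1) := by
        unfold Nat.dist at hlt'
        omega
      have h1' : (a p.1 : ℝ) ≤ a p.2 + (n₀ + 1) := by exact_mod_cast h1
      have h2' : (a p.2 : ℝ) ≤ a p.1 + (n₀ + 1) := by exact_mod_cast h2
      rw [abs_le]
      constructor <;> linarith
  have hsum : ‖∑ k ∈ Finset.Icc 1 N, U (a k) g‖ ^ 2 ≤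
      (N : ℝ) ^ 2 * (ε / 2) + near.card * ‖g‖ ^ 2 := by
    calc ‖∑ k ∈ Finset.Icc 1 N, U (a k) g‖ ^ 2
        = ‖inner 𝕜 (∑ k ∈ Finset.Icc 1 N, U (a k) g) (∑ k ∈ Finset.Icc 1 N, U (a k) g)‖ := by
          rw [inner_self_eq_norm_sq_to_K, norm_pow, RCLike.norm_ofReal, abs_norm]
      _ = ‖∑ p ∈ Q, inner 𝕜 (U (a p.1) g) (U (a p.2) g)‖ := by
          rw [hQ, Finset.sum_product, sum_inner]
          simp_rw [inner_sum]
      _ ≤ ∑ p ∈ Q, (ε / 2 + if |(a p.1 : ℝ) - (a p.2 : ℝ)| ≤ n₀ + 1 then ‖g‖ ^ 2 else 0) :=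
          (norm_sum_le _ _).trans (Finset.sum_le_sum pair)
      _ = (N : ℝ) ^ 2 * (ε / 2) + near.card * ‖g‖ ^ 2 := by
          rw [Finset.sum_add_distrib, Finset.sum_const, nsmul_eq_mul, hQcard, ← Finset.sum_filter,
            Finset.sum_const, nsmul_eq_mul]
  rw [Real.dist_eq, sub_zero, abs_of_nonneg (sq_nonneg _), norm_smul, norm_inv, RCLike.norm_natCast,
    mul_pow]
  calc ((N : ℝ)⁻¹) ^ 2 * ‖∑ k ∈ Finset.Icc 1 N, U (a k) g‖ ^ 2
      ≤ ((N : ℝ)⁻¹) ^ 2 * ((N : ℝ) ^ 2 * (ε / 2) + near.card * ‖g‖ ^ 2) := by gcongr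
    _ = ε / 2 + ‖g‖ ^ 2 * (near.card / (N : ℝ) ^ 2) := by field_simp
    _ < ε := by linarith

end Hilbert

/-! ### Relative mixing over the Pinsker σ-algebra -/

/-- The Koopman isometry `f ↦ f ∘ Tⁿ` of `L²(μ)`. -/
noncomputable def koopman (𝕜 : Type*) [RCLike 𝕜] {T : X → X} (hT : MeasurePreserving T μ μ)
    (n : ℕ) : Lp 𝕜 2 μ →ₗᵢ[𝕜] Lp 𝕜 2 μ :=
  Lp.compMeasurePreservingₗᵢ 𝕜 T^[n] (hT.iterate n)

lemma coeFn_koopman {T : X → X} (hT : MeasurePreserving T μ μ) (n : ℕ) (f : Lp 𝕜 2 μ) :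
    koopman 𝕜 hT n f =ᵐ[μ] fun x => f (T^[n] x) :=
  Lp.coeFn_compMeasurePreserving f (hT.iterate n)

lemma koopman_add {T : X → X} (hT : MeasurePreserving T μ μ) (m n : ℕ) (f : Lp 𝕜 2 μ) :
    koopman 𝕜 hT (m + n) f = koopman 𝕜 hT m (koopman 𝕜 hT n f) := by
  refine Lp.ext ((coeFn_koopman hT (m + n) f).trans ?_)
  have h2 : (fun x => koopman 𝕜 hT n f (T^[m] x)) =ᵐ[μ] fun x => f (T^[n] (T^[m] x)) :=
    (hT.iterate m).quasiMeasurePreserving.ae_eq_comp (coeFn_koopman hT n f)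
  refine EventuallyEq.trans ?_ ((coeFn_koopman hT m _).trans h2).symm
  refine ae_of_all _ fun x => ?_
  dsimp only
  rw [add_comm, Function.iterate_add_apply]

/-- The system is strongly mixing relative to its Pinsker σ-algebra. -/
theorem tendsto_inner_koopman {T : X → X} (hT : MeasurePreserving T μ μ) {g : Lp 𝕜 2 μ}
    (hg : g ∈ (lpMeas 𝕜 𝕜 (pinsker μ hT) 2 μ)ᗮ) :
    Tendsto (fun n => inner 𝕜 (koopman 𝕜 hT n g) g) atTop (𝓝 0) := by
  refine tendsto_inner_of_approx _ fun ε hε => ?_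
  obtain ⟨s, hs, hs2⟩ := (Lp.memLp g).exists_simpleFunc_eLpNorm_sub_lt (by simp)
    (ε := ENNReal.ofReal ε) (by simpa using hε)
  -- The level sets of the simple function `s` form the partition.
  let α : X → s.range := fun x => ⟨s x, s.mem_range_self x⟩
  have hα : Measurable α := s.measurable.subtype_mk
  refine ⟨hs2.toLp s, ?_, fun n => lpMeas 𝕜 𝕜 (futureAlgebra T α n) 2 μ, fun m n hmn f hf => ?_,
    fun n => ?_, fun n => ?_, Submodule.orthogonal_le (iInf_lpMeas_futureAlgebra_le hT hα) hg⟩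
  · rw [← Lp.toLp_coeFn g (Lp.memLp g), ← MemLp.toLp_sub, Lp.norm_toLp]
    exact (ENNReal.lt_ofReal_iff_toReal_lt hs.ne_top).1 hs
  · rw [mem_lpMeas_iff_aestronglyMeasurable] at hf ⊢
    exact hf.mono (futureAlgebra_antitone T α hmn)
  · exact isClosed_aestronglyMeasurable (futureAlgebra_le hT.measurable hα n)
  · rw [mem_lpMeas_iff_aestronglyMeasurable]
    refine ⟨fun x => (α (T^[n] x) : 𝕜), ?_, ?_⟩
    · exact (measurable_subtype_coe.comp (measurable_futureAlgebra T α n)).stronglyMeasurable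
    · exact (coeFn_koopman hT n _).trans
        ((hT.iterate n).quasiMeasurePreserving.ae_eq_comp hs2.coeFn_toLp)

lemma coeFn_average {T : X → X} (hT : MeasurePreserving T μ μ) (a : ℕ → ℕ) {f φ : X → 𝕜}
    {g : Lp 𝕜 2 μ} (hg : g =ᵐ[μ] f - φ) (N : ℕ) :
    ((N : 𝕜)⁻¹ • ∑ k ∈ Finset.Icc 1 N, koopman 𝕜 hT (a k) g : Lp 𝕜 2 μ) =ᵐ[μ]
      average T a f N - average T a φ N := by
  have h1 : ∀ᵐ x ∂μ, ∀ k : ℕ, koopman 𝕜 hT (a k) g x = f (T^[a k] x) - φ (T^[a k] x) :=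
    ae_all_iff.2 fun k => (coeFn_koopman hT (a k) g).trans
      ((hT.iterate (a k)).quasiMeasurePreserving.ae_eq_comp hg)
  filter_upwards [h1, Lp.coeFn_smul (N : 𝕜)⁻¹ (∑ k ∈ Finset.Icc 1 N, koopman 𝕜 hT (a k) g),
    Lp.coeFn_finsetSum (Finset.Icc 1 N) fun k => koopman 𝕜 hT (a k) g] with x h1 h2 h3
  rw [h2, Pi.smul_apply, h3]
  simp only [Finset.sum_apply, h1, average, Pi.sub_apply, smul_eq_mul, Finset.sum_sub_distrib,
    mul_sub]

end PinskerChar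

theorem theorem3p2 (𝕜 : Type*) [RCLike 𝕜] {X : Type*} [MeasurableSpace X]
    (μ : Measure X) [IsProbabilityMeasure μ] (T : X ≃ᵐ X) (hT : MeasurePreserving T μ μ)
    (a : ℕ → ℕ) (ha : ∀ k, 1 ≤ k → 0 < a k) (hstar : PinskerChar.ConditionStar a) :
    PinskerChar.IsCharacteristic 𝕜 μ T (PinskerChar.pinsker μ hT) a := by
  have hle := PinskerChar.pinsker_le hT
  -- In the first component of `IsCharacteristic`, `‹MeasurableSpace X›` is resolved to the
  -- σ-algebra `F` itself; the inclusion in the σ-algebra of the system is `pinsker_le`.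
  refine ⟨le_rfl, fun f hf => ?_⟩
  have : Fact (PinskerChar.pinsker μ hT ≤ ‹MeasurableSpace X›) := ⟨hle⟩
  set g : Lp 𝕜 2 μ := hf.toLp f - (condExpL2 𝕜 𝕜 hle (hf.toLp f) : Lp 𝕜 2 μ) with hgdef
  have hg : g ∈ (lpMeas 𝕜 𝕜 (PinskerChar.pinsker μ hT) 2 μ)ᗮ :=
    Submodule.sub_starProjection_mem_orthogonal _
  have hgae : g =ᵐ[μ] f - μ[f | PinskerChar.pinsker μ hT] :=
    (Lp.coeFn_sub _ _).trans (hf.coeFn_toLp.sub (hf.condExpL2_ae_eq_condExp hle))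
  have hlim := PinskerChar.tendsto_norm_average (PinskerChar.koopman 𝕜 hT)
    (PinskerChar.koopman_add hT) (PinskerChar.tendsto_inner_koopman hT hg) hstar
  have hlim' := ENNReal.tendsto_ofReal hlim
  rw [ENNReal.ofReal_zero] at hlim'
  refine hlim'.congr fun N => ?_
  rw [← eLpNorm_congr_ae (PinskerChar.coeFn_average hT a hgae N), ofReal_norm,
    Lp.enorm_def]
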